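/- **Theorem 4.1 (Poincaré–Wirtinger inequality).** Let $D\subset\mathbb R^d$ be a bounded Lipschitz domain, that is, a nonempty, bounded, connected, open set such that near each of its boundary points, in a suitable orthonormal coordinate system, $D$ coincides with the set of points lying strictly above the graph of a Lipschitz function. For each fixed $r_0>0$ and $\varepsilon_0>0$ there exists a constant $C>0$ (depending only on $D$, $r_0$ and $\varepsilon_0$) such that for every $\varepsilon\in(0,\varepsilon_0]$ and every $v\in L^2(D)$ $$ \int_D (v(x)-v_D)^2\,dx\;\le\; C\int_D\int_{\{\xi\in\mathbb R^d:\ |\xi|\le r_0,\ x+\varepsilon\xi\in D\}}\Bigl(\frac{v(x+\varepsilon\xi)-v(x)}{\varepsilon}\Bigr)^2 d\xi\,dx , $$ where $v_D=\frac1{|D|}\int_D v(x)\,dx$ is the average of $v$ over $D$ and $|\cdot|$ is the Euclidean norm on $\mathbb R^d$. In particular, $C$ depends neither on $\varepsilon\in(0,\varepsilon_0]$ nor on $v$. -/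

import Mathlib

open MeasureTheory
open scoped InnerProductSpace

/-- `D` has Lipschitz boundary: near each of its boundary points, in a suitable orthonormal
system of coordinates (whose last axis is directed by the unit vector `n`), the set `D` is the
strict epigraph of a Lipschitz function `γ` of the remaining coordinates. -/
def HasLipschitzBoundary {d : ℕ} (D : Set (EuclideanSpace ℝ (Fin d))) : Prop :=
  ∀ p ∈ frontier D, ∃ n : EuclideanSpace ℝ (Fin d), ‖n‖ = 1 ∧
    ∃ (γ : (Submodule.span ℝ {n})ᗮ → ℝ) (K : NNReal), LipschitzWith K γ ∧
      ∃ ρ : ℝ, 0 < ρ ∧ ∀ x ∈ Metric.ball p ρ,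
        (x ∈ D ↔ γ ((Submodule.span ℝ {n})ᗮ.orthogonalProjectionOnto x) < ⟪n, x⟫_ℝ)

/-- A bounded Lipschitz domain: a nonempty, connected, open, bounded set with Lipschitz
boundary. (`IsConnected` includes nonemptiness.) -/
structure IsBoundedLipschitzDomain {d : ℕ} (D : Set (EuclideanSpace ℝ (Fin d))) : Prop where
  isOpen : IsOpen D
  isConnected : IsConnected D
  isBounded : Bornology.IsBounded D
  hasLipschitzBoundary : HasLipschitzBoundary D

/-! The plan is to bound the integral of `(v x - v y)^2` over `D × D` by the energy of pairs at
distance at most `δ`, with factor `C * δ⁻¹ ^ (d + 2)` uniform in `δ ≤ δ₀`. Jensen's inequality and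
the substitution `y = x + ε ξ`, with `δ = ε r₀`, then give the theorem.

On a bounded convex set, cut each segment into `N ~ 1/δ` equal steps: Cauchy–Schwarz on the
telescoping sum, translation invariance and rescaling of the increment produce `N ^ (d + 2)`
(`lintegral_sqDiff_le_of_convex`). The estimate survives a measure-preserving Lipschitz
homeomorphism (`PoincareOn.of_convex_preimage`). Near the boundary, a shear flattens the graph and
makes the local piece convex (`exists_poincareOn_of_mem_frontier`). Overlapping pieces can be glued
(`PoincareOn.union`), and compactness of the closure with connectedness of `D` reaches all of `D`
(`PoincareOn.of_locally`). -/

open Module in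
theorem lintegral_comp_add_smul {E : Type*} [NormedAddCommGroup E] [NormedSpace ℝ E]
    [FiniteDimensional ℝ E] [MeasurableSpace E] [BorelSpace E] (μ : Measure E)
    [μ.IsAddHaarMeasure] {f : E → ENNReal} (hf : Measurable f) (x : E) {c : ℝ} (hc : 0 < c) :
    ∫⁻ w, f (x + c • w) ∂μ = ENNReal.ofReal ((c ^ finrank ℝ E)⁻¹) * ∫⁻ y, f y ∂μ := by
  have h1 : ∫⁻ w, f (x + c • w) ∂μ = ∫⁻ y, f (x + y) ∂(μ.map (c • ·)) := by
    rw [lintegral_map (by fun_prop) (by fun_prop)]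
  rw [h1, Measure.map_addHaar_smul μ hc.ne', lintegral_smul_measure,
    lintegral_add_left_eq_self, abs_of_pos (by positivity), smul_eq_mul]

/-! ### Energy of pairs, and the estimate on convex sets -/

/-- The squared difference of the values of `v` at the two points of `z`. -/
noncomputable def sqDiff {E : Type*} (v : E → ℝ) (z : E × E) : ENNReal :=
  ENNReal.ofReal ((v z.1 - v z.2) ^ 2)

/-- The pairs of points of `A` at distance at most `δ`. -/
def nearPairs {E : Type*} [PseudoMetricSpace E] (A : Set E) (δ : ℝ) : Set (E × E) :=
  {z | z.1 ∈ A ∧ z.2 ∈ A ∧ dist z.1 z.2 ≤ δ}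

/-- The energy of `v` carried by the pairs of points of `A` at distance at most `δ`. -/
noncomputable def nearEnergy {E : Type*} [PseudoMetricSpace E] [MeasurableSpace E] (μ : Measure E)
    (A : Set E) (v : E → ℝ) (δ : ℝ) : ENNReal :=
  ∫⁻ x, ∫⁻ y, (nearPairs A δ).indicator (sqDiff v) (x, y) ∂μ ∂μ

theorem measurable_sqDiff {E : Type*} [MeasurableSpace E] {v : E → ℝ} (hv : Measurable v) :
    Measurable (sqDiff v) := by
  unfold sqDiff
  fun_prop

theorem measurableSet_nearPairs {E : Type*} [PseudoMetricSpace E] [SecondCountableTopology E]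
    [MeasurableSpace E] [BorelSpace E] {A : Set E} (hA : MeasurableSet A) (δ : ℝ) :
    MeasurableSet (nearPairs A δ) :=
  (measurable_fst hA).inter ((measurable_snd hA).inter
    (isClosed_le (continuous_fst.dist continuous_snd) continuous_const).measurableSet)

/-- Cauchy–Schwarz applied to a telescoping sum. -/
theorem ofReal_sq_sub_le_sum (a : ℕ → ℝ) (N : ℕ) :
    ENNReal.ofReal ((a 0 - a N) ^ 2) ≤
      N * ∑ k ∈ Finset.range N, ENNReal.ofReal ((a k - a (k + 1)) ^ 2) := by
  rw [← ENNReal.ofReal_sum_of_nonneg (fun _ _ => sq_nonneg _), ← ENNReal.ofReal_natCast,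
    ← ENNReal.ofReal_mul (by positivity), ← Finset.sum_range_sub' a N]
  refine ENNReal.ofReal_le_ofReal ?_
  simpa using sq_sum_le_card_mul_sum_sq (s := Finset.range N) (f := fun k => a k - a (k + 1))

-- Of the exponent, two powers of `N` come from Cauchy–Schwarz and the sum of `N` equal terms; the
-- others are the Jacobian of `w ↦ w / N`.
open Module in
theorem lintegral_sqDiff_le_of_convex {E : Type*} [NormedAddCommGroup E] [NormedSpace ℝ E]
    [FiniteDimensional ℝ E] [MeasurableSpace E] [BorelSpace E] (μ : Measure E)
    [μ.IsAddHaarMeasure] {S : Set E} (hS : Convex ℝ S) (hSm : MeasurableSet S) {R : ℝ}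
    (hR : ∀ x ∈ S, ∀ y ∈ S, dist x y ≤ R) {v : E → ℝ} (hv : Measurable v) {N : ℕ} (hN : 0 < N) :
    ∫⁻ x in S, ∫⁻ y in S, sqDiff v (x, y) ∂μ ∂μ ≤
      (N : ENNReal) ^ (finrank ℝ E + 2) * nearEnergy μ S v (R / N) := by
  have : ProperSpace E := FiniteDimensional.proper ℝ E
  have hN' : (0 : ℝ) < N := by exact_mod_cast hN
  set G : E × E → ENNReal := (nearPairs S (R / N)).indicator (sqDiff v) with hG
  have hGm : Measurable G := (measurable_sqDiff hv).indicator (measurableSet_nearPairs hSm _)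
  set F : E × E → ENNReal := (S ×ˢ S).indicator (sqDiff v) with hF
  have hFm : Measurable F := (measurable_sqDiff hv).indicator (hSm.prod hSm)
  have hpt : ∀ x w, F (x, x + w) ≤ N * ∑ k ∈ Finset.range N,
      G (x + ((k : ℝ) / N) • w, x + ((k : ℝ) / N) • w + (1 / N : ℝ) • w) := by
    intro x w
    by_cases h : (x, x + w) ∈ S ×ˢ S
    · have hz : ∀ k : ℕ, k ≤ N → x + ((k : ℝ) / N) • w ∈ S := by
        intro k hk
        refine hS.add_smul_mem h.1 h.2 ⟨by positivity, ?_⟩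
        rw [div_le_one hN']
        exact_mod_cast hk
      have hs : ∀ k : ℕ, x + ((k : ℝ) / N) • w + (1 / N : ℝ) • w
          = x + (((k + 1 : ℕ) : ℝ) / N) • w := by
        intro k
        rw [add_assoc, ← add_smul]
        push_cast
        rw [add_div]
      have h1 := ofReal_sq_sub_le_sum (fun k => v (x + ((k : ℝ) / N) • w)) N
      rw [hF, Set.indicator_of_mem h, sqDiff]
      simp only [Nat.cast_zero, zero_div, zero_smul, add_zero, div_self hN'.ne', one_smul] at h1
      refine h1.trans (mul_le_mul_right (Finset.sum_le_sum fun k hk => ?_) _)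
      rw [Finset.mem_range] at hk
      rw [hs, hG, Set.indicator_of_mem]
      · rfl
      · refine ⟨hz k hk.le, hz (k + 1) hk, ?_⟩
        have h2 := hR _ h.1 _ h.2
        simp only [dist_eq_norm] at h2 ⊢
        rw [← hs, sub_add_cancel_left, norm_neg, norm_smul, Real.norm_of_nonneg (by positivity),
          one_div_mul_eq_div]
        rw [sub_add_cancel_left, norm_neg] at h2
        gcongr
    · rw [hF, Set.indicator_of_notMem h]
      exact zero_le
  have hlhs : ∫⁻ x in S, ∫⁻ y in S, sqDiff v (x, y) ∂μ ∂μ = ∫⁻ x, ∫⁻ w, F (x, x + w) ∂μ ∂μ := by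
    rw [← lintegral_indicator hSm]
    refine lintegral_congr fun x => ?_
    rw [lintegral_add_left_eq_self (fun y => F (x, y))]
    by_cases hx : x ∈ S
    · rw [Set.indicator_of_mem hx, ← lintegral_indicator hSm]
      refine lintegral_congr fun y => ?_
      by_cases hy : y ∈ S <;> simp [hF, hx, hy]
    · simp [hF, hx]
  have hterm : ∀ k : ℕ, ∫⁻ x, ∫⁻ w, G (x + ((k : ℝ) / N) • w,
      x + ((k : ℝ) / N) • w + (1 / N : ℝ) • w) ∂μ ∂μ
        = (N : ENNReal) ^ finrank ℝ E * nearEnergy μ S v (R / N) := by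
    intro k
    rw [lintegral_lintegral_swap (by fun_prop)]
    -- For fixed `w`, translating `x` by `(k / N) • w` removes the dependence on `k`.
    have h1 : ∀ w, ∫⁻ x, G (x + ((k : ℝ) / N) • w, x + ((k : ℝ) / N) • w + (1 / N : ℝ) • w) ∂μ
        = ∫⁻ x, G (x, x + (1 / N : ℝ) • w) ∂μ := fun w =>
      lintegral_add_right_eq_self (fun x => G (x, x + (1 / N : ℝ) • w)) _
    simp_rw [h1]
    rw [lintegral_lintegral_swap (by fun_prop)]
    have h2 : ∀ x, ∫⁻ w, G (x, x + (1 / N : ℝ) • w) ∂μ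
        = (N : ENNReal) ^ finrank ℝ E * ∫⁻ y, G (x, y) ∂μ := by
      intro x
      rw [lintegral_comp_add_smul μ (f := fun y => G (x, y)) (by fun_prop) x
        (by positivity : (0 : ℝ) < 1 / N)]
      congr 1
      rw [one_div, inv_pow, inv_inv, ENNReal.ofReal_pow hN'.le, ENNReal.ofReal_natCast]
    simp_rw [h2]
    rw [lintegral_const_mul _ hGm.lintegral_prod_right']
    rfl
  calc ∫⁻ x in S, ∫⁻ y in S, sqDiff v (x, y) ∂μ ∂μ
      = ∫⁻ x, ∫⁻ w, F (x, x + w) ∂μ ∂μ := hlhs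
    _ ≤ ∫⁻ x, ∫⁻ w, N * ∑ k ∈ Finset.range N,
      G (x + ((k : ℝ) / N) • w, x + ((k : ℝ) / N) • w + (1 / N : ℝ) • w) ∂μ ∂μ :=
        lintegral_mono fun x => lintegral_mono fun w => hpt x w
    _ = N * ∑ k ∈ Finset.range N, ∫⁻ x, ∫⁻ w,
      G (x + ((k : ℝ) / N) • w, x + ((k : ℝ) / N) • w + (1 / N : ℝ) • w) ∂μ ∂μ := by
        rw [← lintegral_finsetSum, ← lintegral_const_mul]
        · refine lintegral_congr fun x => ?_
          rw [← lintegral_finsetSum, ← lintegral_const_mul]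
          · fun_prop
          · intro k _; fun_prop
        · refine Finset.measurable_sum _ fun k _ => ?_
          exact Measurable.lintegral_prod_right (by fun_prop)
        · intro k _
          exact Measurable.lintegral_prod_right (by fun_prop)
    _ = _ := by
        simp_rw [hterm]
        rw [Finset.sum_const, Finset.card_range, nsmul_eq_mul]
        ring

theorem nearEnergy_mono {E : Type*} [PseudoMetricSpace E] [MeasurableSpace E] (μ : Measure E)
    {A B : Set E} (h : A ⊆ B) (v : E → ℝ) {δ δ' : ℝ} (hδ : δ ≤ δ') :
    nearEnergy μ A v δ ≤ nearEnergy μ B v δ' :=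
  lintegral_mono fun _ => lintegral_mono fun _ =>
    Set.indicator_le_indicator_of_subset
      (show nearPairs A δ ⊆ nearPairs B δ' from
        fun _ hz => ⟨h hz.1, h hz.2.1, hz.2.2.trans hδ⟩) (fun _ => zero_le) _

/-! ### The nonlocal Poincaré property: transport and gluing -/

open Module in
/-- The nonlocal Poincaré inequality on `A`, with the energy of the ambient set `D`, uniformly in
the interaction range `δ ∈ (0, δ₀]`. -/
def PoincareOn {E : Type*} [NormedAddCommGroup E] [NormedSpace ℝ E] [MeasurableSpace E]
    (μ : Measure E) (D : Set E) (δ₀ : ℝ) (A : Set E) : Prop :=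
  ∃ C : ENNReal, C ≠ ⊤ ∧ ∀ δ : ℝ, 0 < δ → δ ≤ δ₀ → ∀ v : E → ℝ, Measurable v →
    ∫⁻ x in A, ∫⁻ y in A, sqDiff v (x, y) ∂μ ∂μ ≤
      C * (ENNReal.ofReal ((δ ^ (finrank ℝ E + 2))⁻¹) * nearEnergy μ D v δ)

open Module in
theorem PoincareOn.of_convex_preimage {E : Type*} [NormedAddCommGroup E] [NormedSpace ℝ E]
    [FiniteDimensional ℝ E] [MeasurableSpace E] [BorelSpace E] {μ : Measure E}
    [μ.IsAddHaarMeasure] (Φ : E ≃ₜ E) (hΦ : MeasurePreserving Φ μ μ) {K : NNReal}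
    (hK : LipschitzWith K Φ) {A D : Set E} (hA : MeasurableSet A) (hAD : A ⊆ D)
    (hconv : Convex ℝ (Φ ⁻¹' A)) (hb : Bornology.IsBounded (Φ ⁻¹' A)) {δ₀ : ℝ} (hδ₀ : 0 < δ₀) :
    PoincareOn μ D δ₀ A := by
  have : ProperSpace E := FiniteDimensional.proper ℝ E
  obtain ⟨R, hR⟩ := Metric.isBounded_iff.1 hb
  -- The absolute value is needed because `R` may be negative when `A` is empty.
  set M : ℝ := K * |R| with hM
  have hM0 : 0 ≤ M := by positivity
  refine ⟨ENNReal.ofReal ((M + 2 * δ₀) ^ (finrank ℝ E + 2)), ENNReal.ofReal_ne_top, ?_⟩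
  intro δ hδ hδ' v hv
  -- The extra `1` keeps `N` positive when `M = 0`; since `δ ≤ δ₀`, the rounding costs at most `2 ≤
  -- 2 * δ₀ / δ`.
  set N : ℕ := ⌈M / δ⌉₊ + 1 with hN
  have hNpos : 0 < N := Nat.succ_pos _
  have hNr : (0 : ℝ) < N := by exact_mod_cast hNpos
  have hMN : M / N ≤ δ := by
    rw [div_le_iff₀ hNr, ← div_le_iff₀' hδ]
    refine (Nat.le_ceil _).trans ?_
    rw [hN]; push_cast; linarith
  have hNle : (N : ℝ) ≤ (M + 2 * δ₀) * δ⁻¹ := by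
    have h1 := Nat.ceil_lt_add_one (a := M / δ) (by positivity)
    rw [← div_eq_mul_inv, add_div]
    have h2 : 2 ≤ 2 * δ₀ / δ := by
      rw [le_div_iff₀ hδ]; linarith
    rw [hN]; push_cast; linarith
  have hconvex := lintegral_sqDiff_le_of_convex μ hconv (Φ.measurable hA) (R := |R|)
    (fun x hx y hy => (hR hx hy).trans (le_abs_self R)) (hv.comp Φ.measurable) hNpos
  have hemb : MeasurableEmbedding Φ := Φ.measurableEmbedding
  have hlhs : ∫⁻ x in Φ ⁻¹' A, ∫⁻ y in Φ ⁻¹' A, sqDiff (v ∘ Φ) (x, y) ∂μ ∂μ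
      = ∫⁻ x in A, ∫⁻ y in A, sqDiff v (x, y) ∂μ ∂μ := by
    rw [← hΦ.setLIntegral_comp_preimage_emb hemb (fun x => ∫⁻ y in A, sqDiff v (x, y) ∂μ)]
    refine lintegral_congr fun x => ?_
    rw [← hΦ.setLIntegral_comp_preimage_emb hemb (fun y => sqDiff v (Φ x, y))]
    rfl
  have hrhs : nearEnergy μ (Φ ⁻¹' A) (v ∘ Φ) (|R| / N) ≤ nearEnergy μ D v δ := by
    refine le_trans ?_ (nearEnergy_mono μ hAD v hMN)
    unfold nearEnergy
    rw [← hΦ.lintegral_comp_emb hemb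
      (fun x => ∫⁻ y, (nearPairs A (M / N)).indicator (sqDiff v) (x, y) ∂μ)]
    refine lintegral_mono fun x => ?_
    dsimp only
    rw [← hΦ.lintegral_comp_emb hemb
      (fun y => (nearPairs A (M / N)).indicator (sqDiff v) (Φ x, y))]
    refine lintegral_mono fun y => ?_
    by_cases h : (x, y) ∈ nearPairs (Φ ⁻¹' A) (|R| / N)
    · rw [Set.indicator_of_mem h, Set.indicator_of_mem]
      · rfl
      · refine ⟨h.1, h.2.1, (hK.dist_le_mul x y).trans ?_⟩
        rw [hM, mul_div_assoc]
        exact mul_le_mul_of_nonneg_left h.2.2 K.2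
    · rw [Set.indicator_of_notMem h]
      exact zero_le
  rw [hlhs] at hconvex
  refine hconvex.trans ?_
  rw [← mul_assoc, ← ENNReal.ofReal_mul (by positivity), ← inv_pow, ← mul_pow,
    ← ENNReal.ofReal_natCast, ← ENNReal.ofReal_pow (by positivity)]
  gcongr

theorem sqDiff_le_two_mul_add {E : Type*} (v : E → ℝ) (x y z : E) :
    sqDiff v (x, y) ≤ 2 * (sqDiff v (x, z) + sqDiff v (y, z)) := by
  unfold sqDiff
  rw [← ENNReal.ofReal_add (by positivity) (by positivity), ← ENNReal.ofReal_ofNat,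
    ← ENNReal.ofReal_mul (by norm_num)]
  refine ENNReal.ofReal_le_ofReal ?_
  dsimp only
  nlinarith [sq_nonneg (v x - v z + (v y - v z))]

/-- Integrate the comparison through an intermediate point `z` over `z ∈ A ∩ B`, then enlarge the
domain of `z` to `A` or to `B`. -/
theorem measure_inter_mul_lintegral_sqDiff_le {E : Type*} [MeasurableSpace E] (μ : Measure E)
    [SFinite μ] {A B : Set E} {v : E → ℝ} (hv : Measurable v) :
    μ (A ∩ B) * ∫⁻ x in A, ∫⁻ y in B, sqDiff v (x, y) ∂μ ∂μ ≤
      2 * (μ B * ∫⁻ x in A, ∫⁻ y in A, sqDiff v (x, y) ∂μ ∂μ +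
        μ A * ∫⁻ x in B, ∫⁻ y in B, sqDiff v (x, y) ∂μ ∂μ) := by
  have hq : Measurable (sqDiff v) := measurable_sqDiff hv
  have hint : ∀ S : Set E, Measurable fun x => ∫⁻ y in S, sqDiff v (x, y) ∂μ := fun S =>
    hq.lintegral_prod_right'
  have hpt : ∀ x y, μ (A ∩ B) * sqDiff v (x, y) ≤
      2 * (∫⁻ z in A, sqDiff v (x, z) ∂μ + ∫⁻ z in B, sqDiff v (y, z) ∂μ) := by
    intro x y
    calc μ (A ∩ B) * sqDiff v (x, y) = ∫⁻ z in A ∩ B, sqDiff v (x, y) ∂μ := by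
          rw [setLIntegral_const, mul_comm]
      _ ≤ ∫⁻ z in A ∩ B, 2 * (sqDiff v (x, z) + sqDiff v (y, z)) ∂μ :=
          lintegral_mono fun z => sqDiff_le_two_mul_add v x y z
      _ = 2 * (∫⁻ z in A ∩ B, sqDiff v (x, z) ∂μ + ∫⁻ z in A ∩ B, sqDiff v (y, z) ∂μ) := by
          rw [lintegral_const_mul _ (by fun_prop), lintegral_add_left (by fun_prop)]
      _ ≤ _ := by
          gcongr
          · exact Set.inter_subset_left
          · exact Set.inter_subset_right
  calc μ (A ∩ B) * ∫⁻ x in A, ∫⁻ y in B, sqDiff v (x, y) ∂μ ∂μ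
      = ∫⁻ x in A, ∫⁻ y in B, μ (A ∩ B) * sqDiff v (x, y) ∂μ ∂μ := by
        rw [← lintegral_const_mul _ (hint B)]
        refine lintegral_congr fun x => ?_
        rw [← lintegral_const_mul _ (by fun_prop)]
    _ ≤ ∫⁻ x in A, ∫⁻ y in B, 2 * (∫⁻ z in A, sqDiff v (x, z) ∂μ +
          ∫⁻ z in B, sqDiff v (y, z) ∂μ) ∂μ ∂μ :=
        lintegral_mono fun x => lintegral_mono fun y => hpt x y
    _ = _ := by
        have hin : ∀ x, ∫⁻ y in B, 2 * (∫⁻ z in A, sqDiff v (x, z) ∂μ +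
            ∫⁻ z in B, sqDiff v (y, z) ∂μ) ∂μ = 2 * (μ B * ∫⁻ z in A, sqDiff v (x, z) ∂μ +
              ∫⁻ y in B, ∫⁻ z in B, sqDiff v (y, z) ∂μ ∂μ) := by
          intro x
          rw [lintegral_const_mul _ ((hint B).const_add _),
            lintegral_add_left measurable_const, setLIntegral_const, mul_comm (μ B)]
        simp_rw [hin]
        rw [lintegral_const_mul _ (((hint A).const_mul _).add_const _),
          lintegral_add_right _ measurable_const, setLIntegral_const,
          lintegral_const_mul _ (hint A), mul_comm (μ A)]

theorem lintegral_sqDiff_le_of_inter {E : Type*} [MeasurableSpace E] (μ : Measure E)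
    [SFinite μ] {A B : Set E} (h0 : μ (A ∩ B) ≠ 0) (hA : μ A ≠ ⊤) {v : E → ℝ}
    (hv : Measurable v) :
    ∫⁻ x in A, ∫⁻ y in B, sqDiff v (x, y) ∂μ ∂μ ≤ (μ (A ∩ B))⁻¹ *
      (2 * (μ B * ∫⁻ x in A, ∫⁻ y in A, sqDiff v (x, y) ∂μ ∂μ +
        μ A * ∫⁻ x in B, ∫⁻ y in B, sqDiff v (x, y) ∂μ ∂μ)) := by
  have htop : μ (A ∩ B) ≠ ⊤ := measure_ne_top_of_subset Set.inter_subset_left hA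
  rw [← ENNReal.div_eq_inv_mul, ENNReal.le_div_iff_mul_le (Or.inl h0) (Or.inl htop), mul_comm]
  exact measure_inter_mul_lintegral_sqDiff_le μ hv

/-- The overlap of positive measure controls the cross terms `A × B` and `B × A` by the diagonal
ones. -/
theorem PoincareOn.union {E : Type*} [NormedAddCommGroup E] [NormedSpace ℝ E]
    [MeasurableSpace E] {μ : Measure E} [SFinite μ] {D A B : Set E} {δ₀ : ℝ}
    (hA : PoincareOn μ D δ₀ A) (hB : PoincareOn μ D δ₀ B) (hμA : μ A ≠ ⊤) (hμB : μ B ≠ ⊤)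
    (h0 : μ (A ∩ B) ≠ 0) : PoincareOn μ D δ₀ (A ∪ B) := by
  obtain ⟨a, ha, hA⟩ := hA
  obtain ⟨b, hb, hB⟩ := hB
  set m := μ (A ∩ B) with hm
  set c := m⁻¹ * (2 * (μ B * a + μ A * b)) with hc
  have hctop : c ≠ ⊤ := by
    have : m⁻¹ ≠ ⊤ := ENNReal.inv_ne_top.2 h0
    finiteness
  refine ⟨(a + c) + (c + b), by finiteness, fun δ hδ hδ' v hv => ?_⟩
  have hq : Measurable (sqDiff v) := measurable_sqDiff hv
  have hint : ∀ S : Set E, Measurable fun x => ∫⁻ y in S, sqDiff v (x, y) ∂μ := fun S =>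
    hq.lintegral_prod_right'
  have hA' := hA δ hδ hδ' v hv
  have hB' := hB δ hδ hδ' v hv
  set e := ENNReal.ofReal ((δ ^ (Module.finrank ℝ E + 2))⁻¹) * nearEnergy μ D v δ
  have hAB : ∫⁻ x in A, ∫⁻ y in B, sqDiff v (x, y) ∂μ ∂μ ≤ c * e := by
    refine (lintegral_sqDiff_le_of_inter μ h0 hμA hv).trans ?_
    calc _ ≤ m⁻¹ * (2 * (μ B * (a * e) + μ A * (b * e))) := by gcongr
      _ = c * e := by rw [hc]; ring
  have hBA : ∫⁻ x in B, ∫⁻ y in A, sqDiff v (x, y) ∂μ ∂μ ≤ c * e := by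
    rw [Set.inter_comm] at hm
    refine (lintegral_sqDiff_le_of_inter μ (hm ▸ h0) hμB hv).trans ?_
    rw [← hm]
    calc _ ≤ m⁻¹ * (2 * (μ A * (b * e) + μ B * (a * e))) := by gcongr
      _ = c * e := by rw [hc]; ring
  calc ∫⁻ x in A ∪ B, ∫⁻ y in A ∪ B, sqDiff v (x, y) ∂μ ∂μ
      ≤ ∫⁻ x in A ∪ B, (∫⁻ y in A, sqDiff v (x, y) ∂μ + ∫⁻ y in B, sqDiff v (x, y) ∂μ) ∂μ :=
        lintegral_mono fun x => lintegral_union_le _ _ _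
    _ = (∫⁻ x in A ∪ B, ∫⁻ y in A, sqDiff v (x, y) ∂μ ∂μ) +
        ∫⁻ x in A ∪ B, ∫⁻ y in B, sqDiff v (x, y) ∂μ ∂μ := lintegral_add_left (hint A) _
    _ ≤ (a * e + c * e) + (c * e + b * e) := by
        gcongr
        · exact (lintegral_union_le _ _ _).trans (by gcongr)
        · exact (lintegral_union_le _ _ _).trans (by gcongr)
    _ = _ := by ring

theorem PoincareOn.of_locally {E : Type*} [NormedAddCommGroup E] [NormedSpace ℝ E]
    [FiniteDimensional ℝ E] [MeasurableSpace E] [BorelSpace E] {μ : Measure E}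
    [μ.IsAddHaarMeasure] {D : Set E} (hopen : IsOpen D) (hconn : IsPreconnected D)
    (hb : Bornology.IsBounded D) {δ₀ : ℝ}
    (hloc : ∀ p ∈ closure D, ∃ U, IsOpen U ∧ p ∈ U ∧ PoincareOn μ D δ₀ (D ∩ U)) :
    PoincareOn μ D δ₀ D := by
  have : ProperSpace E := FiniteDimensional.proper ℝ E
  have hμ : ∀ A ⊆ D, μ A ≠ ⊤ := fun A hA => measure_ne_top_of_subset hA hb.measure_lt_top.ne
  let Good : Set E → Prop := fun A => IsOpen A ∧ A ⊆ D ∧ PoincareOn μ D δ₀ A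
  have hunion : ∀ A B x, Good A → Good B → x ∈ A → x ∈ B → Good (A ∪ B) := by
    intro A B x hA hB hxA hxB
    refine ⟨hA.1.union hB.1, Set.union_subset hA.2.1 hB.2.1,
      hA.2.2.union hB.2.2 (hμ A hA.2.1) (hμ B hB.2.1) ?_⟩
    exact ((hA.1.inter hB.1).measure_pos μ ⟨x, hxA, hxB⟩).ne'
  -- Gluing requires overlap; for two disjoint good sets, this supplies a good set meeting both.
  have hlink : ∀ x ∈ D, ∀ y ∈ D, ∃ A, Good A ∧ x ∈ A ∧ y ∈ A := by
    intro x hx y hy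
    refine hconn.induction₂ (fun x y => ∃ A, Good A ∧ x ∈ A ∧ y ∈ A) ?_ ?_ ?_ hx hy
    · intro x hx
      obtain ⟨U, hU, hxU, hP⟩ := hloc x (subset_closure hx)
      filter_upwards [inter_mem_nhdsWithin D (hU.mem_nhds hxU)] with y hy
      exact ⟨D ∩ U, ⟨hopen.inter hU, Set.inter_subset_left, hP⟩, ⟨hx, hxU⟩, hy⟩
    · rintro x y z - - - ⟨A, hA, hxA, hyA⟩ ⟨B, hB, hyB, hzB⟩
      exact ⟨A ∪ B, hunion A B y hA hB hyA hyB, Or.inl hxA, Or.inr hzB⟩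
    · rintro x y - - ⟨A, hA, hxA, hyA⟩
      exact ⟨A, hA, hyA, hxA⟩
  have hcompact : IsCompact (closure D) := hb.isCompact_closure
  obtain ⟨A, hA, hDA⟩ : ∃ A, Good A ∧ D ∩ closure D ⊆ A := by
    refine hcompact.induction_on (p := fun S => ∃ A, Good A ∧ D ∩ S ⊆ A) ?_ ?_ ?_ ?_
    · exact ⟨∅, ⟨isOpen_empty, Set.empty_subset _, 0, by simp, by simp⟩, by simp⟩
    · rintro S T hST ⟨A, hA, hTA⟩
      exact ⟨A, hA, (Set.inter_subset_inter_right D hST).trans hTA⟩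
    · rintro S T ⟨A, hA, hSA⟩ ⟨B, hB, hTB⟩
      rw [Set.inter_union_distrib_left]
      rcases A.eq_empty_or_nonempty with rfl | ⟨x, hx⟩
      · exact ⟨B, hB, Set.union_subset (hSA.trans (Set.empty_subset B)) hTB⟩
      rcases B.eq_empty_or_nonempty with rfl | ⟨y, hy⟩
      · exact ⟨A, hA, Set.union_subset hSA (hTB.trans (Set.empty_subset A))⟩
      obtain ⟨G, hG, hxG, hyG⟩ := hlink x (hA.2.1 hx) y (hB.2.1 hy)
      refine ⟨A ∪ G ∪ B, hunion (A ∪ G) B y (hunion A G x hA hG hx hxG) hB (Or.inr hyG) hy,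
        Set.union_subset (hSA.trans fun _ h => Or.inl (Or.inl h)) (hTB.trans fun _ h => Or.inr h)⟩
    · intro p hp
      obtain ⟨U, hU, hpU, hP⟩ := hloc p hp
      exact ⟨U, mem_nhdsWithin_of_mem_nhds (hU.mem_nhds hpU), D ∩ U,
        ⟨hopen.inter hU, Set.inter_subset_left, hP⟩, subset_rfl⟩
  rw [Set.inter_eq_left.2 subset_closure] at hDA
  rw [hA.2.1.antisymm hDA] at hA
  exact hA.2.2

/-! ### Straightening a Lipschitz graph by a shear -/

section Shear

variable {E : Type*} [NormedAddCommGroup E] [InnerProductSpace ℝ E]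

/-- The orthogonal projection onto the hyperplane orthogonal to `n`. -/
noncomputable abbrev hyperplaneProj (n : E) : E →L[ℝ] (Submodule.span ℝ {n})ᗮ :=
  (Submodule.span ℝ {n})ᗮ.orthogonalProjectionOnto

theorem coe_hyperplaneProj_add {n : E} (hn : ‖n‖ = 1) (x : E) :
    (hyperplaneProj n x : E) + ⟪n, x⟫_ℝ • n = x := by
  have h := Submodule.starProjection_add_starProjection_orthogonal (K := Submodule.span ℝ {n}) x
  rw [Submodule.starProjection_unit_singleton ℝ hn, add_comm] at h
  exact h

theorem hyperplaneProj_self (n : E) : hyperplaneProj n n = 0 :=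
  Submodule.orthogonalProjectionOnto_apply_of_mem_orthogonal
    (Submodule.le_orthogonal_orthogonal _ (Submodule.mem_span_singleton_self n))

theorem hyperplaneProj_add_smul (n x : E) (t : ℝ) :
    hyperplaneProj n (x + t • n) = hyperplaneProj n x := by
  rw [map_add, map_smul, hyperplaneProj_self, smul_zero, add_zero]

theorem inner_add_smul_self {n : E} (hn : ‖n‖ = 1) (x : E) (t : ℝ) :
    ⟪n, x + t • n⟫_ℝ = ⟪n, x⟫_ℝ + t := by
  rw [inner_add_right, inner_smul_right, real_inner_self_eq_norm_sq, hn]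
  ring

/-- The shear in the direction `n` with profile `γ`. -/
noncomputable def shear (n : E) (γ : (Submodule.span ℝ {n})ᗮ → ℝ) (hγ : Continuous γ) :
    E ≃ₜ E where
  toFun x := x + γ (hyperplaneProj n x) • n
  invFun x := x - γ (hyperplaneProj n x) • n
  left_inv x := by
    dsimp only
    rw [hyperplaneProj_add_smul, add_sub_cancel_right]
  right_inv x := by
    dsimp only
    rw [sub_eq_add_neg, ← neg_smul, hyperplaneProj_add_smul, neg_smul, neg_add_cancel_right]
  continuous_toFun := by fun_prop
  continuous_invFun := by fun_prop

theorem shear_apply (n : E) (γ : (Submodule.span ℝ {n})ᗮ → ℝ) (hγ : Continuous γ) (x : E) :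
    shear n γ hγ x = x + γ (hyperplaneProj n x) • n :=
  rfl

theorem lipschitzWith_shear {n : E} (hn : ‖n‖ = 1) {γ : (Submodule.span ℝ {n})ᗮ → ℝ}
    {K : NNReal} (hγ : LipschitzWith K γ) :
    LipschitzWith (1 + K) (shear n γ hγ.continuous) := by
  refine LipschitzWith.id.add (f := id) (g := fun x => γ (hyperplaneProj n x) • n) ?_
  refine LipschitzWith.of_dist_le_mul fun x y => ?_
  rw [dist_eq_norm, ← sub_smul, norm_smul, hn, mul_one, ← dist_eq_norm]
  refine (hγ.dist_le_mul _ _).trans (mul_le_mul_of_nonneg_left ?_ K.2)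
  simpa using (Submodule.lipschitzWith_orthogonalProjectionOnto
    (Submodule.span ℝ {n})ᗮ).dist_le_mul x y

variable [FiniteDimensional ℝ E]

/-- The splitting of the space into the hyperplane orthogonal to the unit vector `n` and the
coordinate along `n`. -/
noncomputable def hyperplaneSplitting (n : E) (hn : ‖n‖ = 1) :
    E ≃L[ℝ] (Submodule.span ℝ {n})ᗮ × ℝ :=
  LinearEquiv.toContinuousLinearEquiv
    { (hyperplaneProj n).toLinearMap.prod (innerₛₗ ℝ n) with
      invFun := fun p => (p.1 : E) + p.2 • n
      left_inv := fun x => coe_hyperplaneProj_add hn x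
      right_inv := fun p => by
        have h1 : hyperplaneProj n (p.1 : E) = p.1 :=
          Submodule.orthogonalProjectionOnto_mem_subspace_eq_self p.1
        have h2 : ⟪n, (p.1 : E)⟫_ℝ = 0 :=
          Submodule.mem_orthogonal_singleton_iff_inner_right.1 p.1.2
        refine Prod.ext ?_ ?_
        · exact (hyperplaneProj_add_smul n _ _).trans h1
        · exact (inner_add_smul_self hn _ _).trans (by rw [h2, zero_add]) }

variable [MeasurableSpace E] [BorelSpace E]

/-- In hyperplane and normal coordinates, Haar measure is a multiple of the product measure, and the
shear translates each normal fibre. -/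
theorem measurePreserving_shear {n : E} (hn : ‖n‖ = 1) (γ : (Submodule.span ℝ {n})ᗮ → ℝ)
    (hγ : Continuous γ) (μ : Measure E) [μ.IsAddHaarMeasure] :
    MeasurePreserving (shear n γ hγ) μ μ := by
  set e := (hyperplaneSplitting n hn).toHomeomorph.toMeasurableEquiv with he
  set ν : Measure ((Submodule.span ℝ {n})ᗮ × ℝ) := μ.map e with hν
  have : ν.IsAddHaarMeasure := (hyperplaneSplitting n hn).isAddHaarMeasure_map μ
  have hνeq := Measure.isAddLeftInvariant_eq_smul ν
    ((volume : Measure (Submodule.span ℝ {n})ᗮ).prod (volume : Measure ℝ))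
  have hS : MeasurePreserving (fun p : (Submodule.span ℝ {n})ᗮ × ℝ => (p.1, p.2 + γ p.1)) ν ν := by
    rw [hνeq]
    refine MeasurePreserving.smul_measure ?_ _
    exact (MeasurePreserving.id _).skew_product (g := fun w t => t + γ w)
      (Continuous.measurable (by fun_prop))
      (Filter.Eventually.of_forall fun w => map_add_right_eq_self _ _)
  have heμ : MeasurePreserving e μ ν := e.measurable.measurePreserving μ
  have h := (heμ.symm e).comp (hS.comp heμ)
  convert h using 1
  funext x
  refine ((MeasurableEquiv.symm_apply_eq e).2 ?_).symm
  change (hyperplaneProj n x, ⟪n, x⟫_ℝ + γ (hyperplaneProj n x)) =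
    (hyperplaneProj n (x + γ (hyperplaneProj n x) • n), ⟪n, x + γ (hyperplaneProj n x) • n⟫_ℝ)
  rw [hyperplaneProj_add_smul, inner_add_smul_self hn]

theorem exists_poincareOn_of_mem_frontier {D : Set E} (hD : IsOpen D) {p : E}
    (hp : p ∈ frontier D) {n : E} (hn : ‖n‖ = 1) {γ : (Submodule.span ℝ {n})ᗮ → ℝ} {K : NNReal}
    (hγ : LipschitzWith K γ) {ρ : ℝ} (hρ : 0 < ρ)
    (hball : ∀ x ∈ Metric.ball p ρ, (x ∈ D ↔ γ (hyperplaneProj n x) < ⟪n, x⟫_ℝ))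
    (μ : Measure E) [μ.IsAddHaarMeasure] {δ₀ : ℝ} (hδ₀ : 0 < δ₀) :
    ∃ U, IsOpen U ∧ p ∈ U ∧ PoincareOn μ D δ₀ (D ∩ U) := by
  have hγc := hγ.continuous
  -- The boundary point lies on the graph: it is outside the open set `D`, yet a limit of points
  -- above the graph.
  have hpγ : ⟪n, p⟫_ℝ = γ (hyperplaneProj n p) := by
    apply le_antisymm
    · have hpD : p ∉ D := fun h => by
        rw [hD.frontier_eq] at hp
        exact hp.2 h
      rw [hball p (Metric.mem_ball_self hρ)] at hpD
      exact not_lt.1 hpD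
    · have hcl : p ∈ closure (Metric.ball p ρ ∩ D) :=
        Metric.isOpen_ball.inter_closure ⟨Metric.mem_ball_self hρ, frontier_subset_closure hp⟩
      have hclosed : IsClosed {x : E | γ (hyperplaneProj n x) ≤ ⟪n, x⟫_ℝ} :=
        isClosed_le (by fun_prop) (by fun_prop)
      exact hclosed.closure_subset_iff.2 (fun x hx => ((hball x hx.1).1 hx.2).le) hcl
  -- In `U` the tangential displacement from `p` is below `r` and the normal one below `r + K * r`,
  -- so `U` fits in the ball of radius `ρ`.
  set r : ℝ := ρ / (2 + K) with hr
  have hr0 : 0 < r := by positivity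
  have hrρ : r * (2 + K) = ρ := div_mul_cancel₀ _ (by positivity)
  set U : Set E := {x | ‖hyperplaneProj n x - hyperplaneProj n p‖ < r ∧
    |⟪n, x⟫_ℝ - γ (hyperplaneProj n x)| < r} with hU
  have hUopen : IsOpen U :=
    (isOpen_lt (f := fun x => ‖hyperplaneProj n x - hyperplaneProj n p‖) (by fun_prop)
      continuous_const).inter
      (isOpen_lt (f := fun x => |⟪n, x⟫_ℝ - γ (hyperplaneProj n x)|) (by fun_prop)
        continuous_const)
  have hUball : U ⊆ Metric.ball p ρ := by
    intro x hx
    rw [mem_ball_iff_norm, ← coe_hyperplaneProj_add hn (x - p)]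
    refine (norm_add_le _ _).trans_lt ?_
    rw [norm_smul, hn, mul_one, ← Submodule.coe_norm, map_sub, inner_sub_right, hpγ,
      Real.norm_eq_abs]
    have h1 := hγ.dist_le_mul (hyperplaneProj n x) (hyperplaneProj n p)
    rw [Real.dist_eq, dist_eq_norm] at h1
    have h2 : (K : ℝ) * ‖hyperplaneProj n x - hyperplaneProj n p‖ ≤ K * r :=
      mul_le_mul_of_nonneg_left hx.1.le K.2
    have h3 := abs_add_le (⟪n, x⟫_ℝ - γ (hyperplaneProj n x))
      (γ (hyperplaneProj n x) - γ (hyperplaneProj n p))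
    rw [sub_add_sub_cancel] at h3
    linarith [hx.1, hx.2]
  -- After straightening, the piece is a cylinder over a ball, hence convex and bounded.
  have hpre : shear n γ hγc ⁻¹' (D ∩ U) =
      {z | ‖hyperplaneProj n z - hyperplaneProj n p‖ < r} ∩ {z | 0 < ⟪n, z⟫_ℝ} ∩
        {z | ⟪n, z⟫_ℝ < r} := by
    ext z
    have h1 : shear n γ hγc z ∈ D ∩ U ↔ γ (hyperplaneProj n (shear n γ hγc z)) <
        ⟪n, shear n γ hγc z⟫_ℝ ∧ shear n γ hγc z ∈ U :=
      ⟨fun h => ⟨(hball _ (hUball h.2)).1 h.1, h.2⟩, fun h => ⟨(hball _ (hUball h.2)).2 h.1, h.2⟩⟩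
    rw [Set.mem_preimage, h1, hU]
    simp only [Set.mem_ofPred_eq, Set.mem_inter_iff, shear_apply, hyperplaneProj_add_smul,
      inner_add_smul_self hn, add_sub_cancel_right, lt_add_iff_pos_left, abs_lt]
    constructor
    · rintro ⟨h, h', -, h''⟩
      exact ⟨⟨h', h⟩, h''⟩
    · rintro ⟨⟨h', h⟩, h''⟩
      exact ⟨h, h', by linarith, h''⟩
  refine ⟨U, hUopen, ⟨by simpa using hr0, by simpa [hpγ] using hr0⟩, ?_⟩
  refine PoincareOn.of_convex_preimage (shear n γ hγc) (measurePreserving_shear hn γ hγc μ)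
    (lipschitzWith_shear hn hγ) (hD.inter hUopen).measurableSet Set.inter_subset_left ?_ ?_ hδ₀
  · rw [hpre]
    refine Convex.inter (Convex.inter ?_ ?_) ?_
    · have h := (convex_ball (hyperplaneProj n p) r).linear_preimage
        (hyperplaneProj n : E →ₗ[ℝ] _)
      convert h using 1
      ext z
      exact mem_ball_iff_norm.symm
    · exact convex_halfSpace_gt (innerSL ℝ n).toLinearMap.isLinear 0
    · exact convex_halfSpace_lt (innerSL ℝ n).toLinearMap.isLinear r
  · rw [hpre, isBounded_iff_forall_norm_le]
    refine ⟨r + ‖hyperplaneProj n p‖ + r, ?_⟩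
    rintro z ⟨⟨h1, h2⟩, h3⟩
    simp only [Set.mem_ofPred_eq] at h1 h2 h3
    rw [← coe_hyperplaneProj_add hn z]
    refine (norm_add_le _ _).trans ?_
    rw [norm_smul, hn, mul_one, Real.norm_eq_abs, abs_of_pos h2, ← Submodule.coe_norm]
    have h4 := norm_add_le (hyperplaneProj n z - hyperplaneProj n p) (hyperplaneProj n p)
    rw [sub_add_cancel] at h4
    linarith

end Shear

theorem IsBoundedLipschitzDomain.poincareOn {d : ℕ} {D : Set (EuclideanSpace ℝ (Fin d))}
    (hD : IsBoundedLipschitzDomain D) {δ₀ : ℝ} (hδ₀ : 0 < δ₀) : PoincareOn volume D δ₀ D := by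
  refine PoincareOn.of_locally hD.isOpen hD.isConnected.isPreconnected hD.isBounded ?_
  intro p hp
  by_cases hpD : p ∈ D
  · obtain ⟨r, hr, hball⟩ := Metric.isOpen_iff.1 hD.isOpen p hpD
    refine ⟨Metric.ball p r, Metric.isOpen_ball, Metric.mem_ball_self hr, ?_⟩
    rw [Set.inter_eq_right.2 hball]
    exact PoincareOn.of_convex_preimage (Homeomorph.refl _) (MeasurePreserving.id _)
      LipschitzWith.id Metric.isOpen_ball.measurableSet hball (convex_ball p r)
      Metric.isBounded_ball hδ₀
  · have hpf : p ∈ frontier D := by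
      rw [hD.isOpen.frontier_eq]
      exact ⟨hp, hpD⟩
    obtain ⟨n, hn, γ, K, hγ, ρ, hρ, hball⟩ := hD.hasLipschitzBoundary p hpf
    exact exists_poincareOn_of_mem_frontier hD.isOpen hpf hn hγ hρ hball volume hδ₀

/-! ### From the energy of pairs to the stated inequality -/

/-- Jensen's inequality for `t ↦ (v x - t) ^ 2`, for each fixed `x`. -/
theorem lintegral_sq_sub_average_le {Ω : Type*} [MeasurableSpace Ω] {μ : Measure Ω}
    [IsFiniteMeasure μ] [NeZero μ] {v : Ω → ℝ} (hv : MemLp v 2 μ) :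
    ∫⁻ x, ENNReal.ofReal ((v x - ⨍ y, v y ∂μ) ^ 2) ∂μ ≤
      (μ Set.univ)⁻¹ * ∫⁻ x, ∫⁻ y, sqDiff v (x, y) ∂μ ∂μ := by
  have h0 : μ Set.univ ≠ 0 := NeZero.ne _
  rw [← lintegral_const_mul' _ _ (ENNReal.inv_ne_top.2 h0)]
  refine lintegral_mono fun x => ?_
  have hint : Integrable (fun y => (v x - v y) ^ 2) μ :=
    ((memLp_const (v x)).sub hv).integrable_sq
  have hconv : ConvexOn ℝ Set.univ fun t : ℝ => (v x - t) ^ 2 := by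
    have h := (even_two.convexOn_pow (𝕜 := ℝ)).comp_affineMap
      (AffineMap.const ℝ ℝ (v x) - AffineMap.id ℝ ℝ)
    simpa [Function.comp_def] using h
  have hJ := hconv.map_average_le (μ := μ) (f := v) (by fun_prop) isClosed_univ (by simp)
    (hv.integrable (by norm_num)) hint
  refine (ENNReal.ofReal_le_ofReal hJ).trans_eq ?_
  have hpos : 0 < μ.real Set.univ := ENNReal.toReal_pos h0 (measure_ne_top _ _)
  rw [average_eq, smul_eq_mul, ENNReal.ofReal_mul (by positivity), ENNReal.ofReal_inv_of_pos hpos,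
    ofReal_measureReal, ofReal_integral_eq_lintegral_ofReal hint
      (Filter.Eventually.of_forall fun _ => sq_nonneg _)]
  rfl

-- Substituting `y = x + ε • ξ` gives the Jacobian, and the difference quotient gives the remaining
-- `ε ^ 2`.
open Module in
theorem lintegral_sq_div_eq_nearEnergy {E : Type*} [NormedAddCommGroup E] [NormedSpace ℝ E]
    [FiniteDimensional ℝ E] [MeasurableSpace E] [BorelSpace E] (μ : Measure E)
    [μ.IsAddHaarMeasure] {D : Set E} (hD : MeasurableSet D) {v : E → ℝ} (hv : Measurable v)
    {ε : ℝ} (hε : 0 < ε) (r : ℝ) :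
    ∫⁻ x in D, ∫⁻ ξ in {ξ | ‖ξ‖ ≤ r ∧ x + ε • ξ ∈ D},
        ENNReal.ofReal (((v (x + ε • ξ) - v x) / ε) ^ 2) ∂μ ∂μ =
      ENNReal.ofReal ((ε ^ (finrank ℝ E + 2))⁻¹) * nearEnergy μ D v (ε * r) := by
  have : ProperSpace E := FiniteDimensional.proper ℝ E
  have hG : Measurable ((nearPairs D (ε * r)).indicator (sqDiff v)) :=
    (measurable_sqDiff hv).indicator (measurableSet_nearPairs hD _)
  rw [nearEnergy, ← lintegral_const_mul _ hG.lintegral_prod_right', ← lintegral_indicator hD]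
  refine lintegral_congr fun x => ?_
  have hset : MeasurableSet {ξ | ‖ξ‖ ≤ r ∧ x + ε • ξ ∈ D} := by
    have hm : Measurable fun ξ : E => x + ε • ξ := by fun_prop
    exact (isClosed_le continuous_norm continuous_const).measurableSet.inter (hm hD)
  by_cases hx : x ∈ D
  · rw [Set.indicator_of_mem hx, pow_add, mul_inv, mul_comm (ε ^ _)⁻¹,
      ENNReal.ofReal_mul (by positivity), mul_assoc,
      ← lintegral_comp_add_smul μ (f := fun y => (nearPairs D (ε * r)).indicator (sqDiff v) (x, y))
        (hG.comp measurable_prodMk_left) x hε,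
      ← lintegral_const_mul' _ _ ENNReal.ofReal_ne_top, ← lintegral_indicator hset]
    refine lintegral_congr fun ξ => ?_
    have hmem : (x, x + ε • ξ) ∈ nearPairs D (ε * r) ↔ ξ ∈ {ξ | ‖ξ‖ ≤ r ∧ x + ε • ξ ∈ D} := by
      simp only [nearPairs, Set.mem_ofPred_eq, hx, true_and, dist_self_add_right, norm_smul,
        Real.norm_of_nonneg hε.le, mul_le_mul_iff_right₀ hε]
      exact and_comm
    by_cases hξ : ξ ∈ {ξ | ‖ξ‖ ≤ r ∧ x + ε • ξ ∈ D}
    · rw [Set.indicator_of_mem hξ, Set.indicator_of_mem (hmem.2 hξ), sqDiff,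
        ← ENNReal.ofReal_mul (by positivity)]
      congr 1
      rw [div_pow, div_eq_inv_mul]
      ring
    · rw [Set.indicator_of_notMem hξ,
        Set.indicator_of_notMem (fun h => hξ (hmem.1 h)), mul_zero]
  · have h0 : ∀ y, (nearPairs D (ε * r)).indicator (sqDiff v) (x, y) = 0 := fun y =>
      Set.indicator_of_notMem (fun h => hx h.1) _
    simp [hx, h0]

/-- Null sets pull back to null sets under `ξ ↦ x + ε • ξ`; this lets `v` be replaced by a
measurable representative inside the inner integral. -/
theorem ae_mem_imp_eq_comp_add_smul {E F : Type*} [NormedAddCommGroup E] [NormedSpace ℝ E]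
    [FiniteDimensional ℝ E] [MeasurableSpace E] [BorelSpace E] {μ : Measure E}
    [μ.IsAddHaarMeasure] {D : Set E} (hD : MeasurableSet D) {v w : E → F}
    (h : v =ᵐ[μ.restrict D] w) (x : E) {ε : ℝ} (hε : ε ≠ 0) :
    ∀ᵐ ξ ∂μ, x + ε • ξ ∈ D → v (x + ε • ξ) = w (x + ε • ξ) := by
  have h' : ∀ᵐ y ∂μ, y ∈ D → v y = w y := (ae_restrict_iff' hD).1 h
  exact ((measurePreserving_add_left μ x).quasiMeasurePreserving.comp
    (Measure.quasiMeasurePreserving_smul μ hε)).ae h'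

theorem theorem4p1 (d : ℕ) (D : Set (EuclideanSpace ℝ (Fin d)))
    (hD : IsBoundedLipschitzDomain D) (r₀ : ℝ) (hr₀ : 0 < r₀) (ε₀ : ℝ) (hε₀ : 0 < ε₀) :
    ∃ C : ℝ, 0 < C ∧ ∀ ε : ℝ, 0 < ε → ε ≤ ε₀ →
      ∀ v : EuclideanSpace ℝ (Fin d) → ℝ, MemLp v 2 (volume.restrict D) →
        ∫⁻ x in D, ENNReal.ofReal ((v x - ⨍ y in D, v y) ^ 2) ≤
          ENNReal.ofReal C * ∫⁻ x in D, ∫⁻ ξ in {ξ | ‖ξ‖ ≤ r₀ ∧ x + ε • ξ ∈ D},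
            ENNReal.ofReal (((v (x + ε • ξ) - v x) / ε) ^ 2) := by
  have hDm : MeasurableSet D := hD.isOpen.measurableSet
  have hDpos : volume D ≠ 0 := (hD.isOpen.measure_pos volume hD.isConnected.nonempty).ne'
  have : IsFiniteMeasure (volume.restrict D) :=
    isFiniteMeasure_restrict.2 hD.isBounded.measure_lt_top.ne
  have : NeZero (volume.restrict D) := ⟨by rwa [Ne, Measure.restrict_eq_zero]⟩
  obtain ⟨C, hC, hP⟩ := hD.poincareOn (δ₀ := ε₀ * r₀) (by positivity)
  set K : ENNReal := (volume D)⁻¹ * (C * ENNReal.ofReal ((r₀ ^ (d + 2))⁻¹)) with hK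
  have hKtop : K ≠ ⊤ := by
    have := ENNReal.inv_ne_top.2 hDpos
    finiteness
  -- Adding `1` serves only to make the constant visibly positive.
  refine ⟨K.toReal + 1, by positivity, fun ε hε hε' v hv => ?_⟩
  obtain ⟨w, hw, hvw⟩ : ∃ w, Measurable w ∧ v =ᵐ[volume.restrict D] w :=
    ⟨hv.1.mk v, hv.1.stronglyMeasurable_mk.measurable, hv.1.ae_eq_mk⟩
  have hlhs : ∫⁻ x in D, ENNReal.ofReal ((v x - ⨍ y in D, v y) ^ 2) =
      ∫⁻ x in D, ENNReal.ofReal ((w x - ⨍ y in D, w y) ^ 2) := by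
    rw [average_congr hvw]
    refine lintegral_congr_ae ?_
    filter_upwards [hvw] with x hx
    rw [hx]
  have hrhs : ∫⁻ x in D, ∫⁻ ξ in {ξ | ‖ξ‖ ≤ r₀ ∧ x + ε • ξ ∈ D},
        ENNReal.ofReal (((v (x + ε • ξ) - v x) / ε) ^ 2) =
      ∫⁻ x in D, ∫⁻ ξ in {ξ | ‖ξ‖ ≤ r₀ ∧ x + ε • ξ ∈ D},
        ENNReal.ofReal (((w (x + ε • ξ) - w x) / ε) ^ 2) := by
    refine lintegral_congr_ae ?_
    filter_upwards [hvw] with x hx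
    have hm : Measurable fun ξ : EuclideanSpace ℝ (Fin d) => x + ε • ξ := by fun_prop
    refine setLIntegral_congr_fun_ae
      ((isClosed_le continuous_norm continuous_const).measurableSet.inter (hm hDm)) ?_
    filter_upwards [ae_mem_imp_eq_comp_add_smul hDm hvw x hε.ne'] with ξ hξ hmem
    rw [hx, hξ hmem.2]
  rw [hlhs, hrhs, lintegral_sq_div_eq_nearEnergy volume hDm hw hε]
  refine (lintegral_sq_sub_average_le (hv.ae_eq hvw)).trans ?_
  rw [Measure.restrict_apply_univ]
  have hP' := hP (ε * r₀) (by positivity) (by gcongr) w hw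
  rw [finrank_euclideanSpace_fin] at hP' ⊢
  calc _ ≤ (volume D)⁻¹ * (C * (ENNReal.ofReal (((ε * r₀) ^ (d + 2))⁻¹) *
        nearEnergy volume D w (ε * r₀))) := by gcongr
    _ = K * (ENNReal.ofReal ((ε ^ (d + 2))⁻¹) * nearEnergy volume D w (ε * r₀)) := by
        rw [hK, mul_pow, mul_inv, mul_comm (ε ^ _)⁻¹, ENNReal.ofReal_mul (by positivity)]
        ring
    _ ≤ _ := by
        gcongr
        rw [← ENNReal.ofReal_toReal hKtop]
        refine ENNReal.ofReal_le_ofReal ?_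
        rw [ENNReal.toReal_ofReal ENNReal.toReal_nonneg]
        linarith
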